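/- Let $p_0,p_1,p_2,p>0$. For $n\in\{1,2,3\}$ there is exactly one probability measure $\mu^{(n)}$ on $\mathbb R$ with Jacobi coefficients $\beta_k=0$ for all $k\ge0$, $\gamma_k=p_k$ for $0\le k\le n-1$ and $\gamma_k=p$ for $k\ge n$; that is, $\mu^{(n)}$ has finite moments of all orders and its monic orthogonal polynomials are given by $P_0=1$, $P_1=x$, $xP_{k+1}=P_{k+2}+\gamma_kP_k$ $(k\ge0)$. The part of $\mu^{(n)}$ that is absolutely continuous with respect to Lebesgue measure has density $\rho^{(n)}$, where, with $I=I_{(-2\sqrt p,\,2\sqrt p)}$ the indicator function of the interval $(-2\sqrt p,2\sqrt p)$, $$\rho^{(1)}(x)=\frac1{2\pi}\,\frac{p_0\sqrt{4p-x^2}}{(p-p_0)x^2+p_0^2}\,I(x),$$ $$\rho^{(2)}(x)=\frac1{2\pi}\,\frac{p_0p_1\sqrt{4p-x^2}}{(p-p_1)x^4+\{p_0(p_1-2p)+p_1^2\}x^2+p_0^2p}\,I(x),$$ $$\rho^{(3)}(x)=\frac1{2\pi}\,\frac{p_0p_1p_2\sqrt{4p-x^2}}{(p-p_2)x^6+c_1x^4+c_2x^2+p_0^2p_2^2}\,I(x),$$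 $$c_1=(p_0+p_1)(p_2-2p)+(p_0+p_2)p_2,\qquad c_2=(p_0+p_1)^2p-p_0p_2(p_0+p_1+2p_2).$$ The three denominators are positive on $(-2\sqrt p,2\sqrt p)$. -/

import Mathlib

open MeasureTheory Polynomial

/-- The monic polynomials given by the three-term recurrence
`P 0 = 1`, `P 1 = X - β 0`, `X * P (n+1) = P (n+2) + β (n+1) * P (n+1) + γ n * P n`. -/
noncomputable def jacobiPoly (β γ : ℕ → ℝ) : ℕ → ℝ[X]
  | 0 => 1
  | 1 => X - C (β 0)
  | n + 2 => (X - C (β (n + 1))) * jacobiPoly β γ (n + 1) - C (γ n) * jacobiPoly β γ n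

/-- `β, γ` are the Jacobi coefficients of the measure `μ` on the real line: all moments of `μ` are
finite, and the monic polynomials with recurrence coefficients `β, γ` are orthogonal in `L²(μ)`
(and none of them is null there). -/
structure HasJacobiCoefficients (μ : Measure ℝ) (β γ : ℕ → ℝ) : Prop where
  integrable_pow : ∀ k : ℕ, Integrable (fun x : ℝ => x ^ k) μ
  orthogonal : ∀ m n : ℕ, m ≠ n →
    ∫ x, (jacobiPoly β γ m).eval x * (jacobiPoly β γ n).eval x ∂μ = 0
  norm_pos : ∀ n : ℕ, 0 < ∫ x, ((jacobiPoly β γ n).eval x) ^ 2 ∂μ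

/-- The coefficient sequence `q 0, …, q (n-1), p, p, p, …`. -/
def caseCoeff {n : ℕ} (q : Fin n → ℝ) (p : ℝ) : ℕ → ℝ :=
  fun k => if h : k < n then q ⟨k, h⟩ else p

/-- The part of `μ` that is absolutely continuous with respect to Lebesgue measure has the
(nonnegative, measurable) density `ρ`. -/
def IsAbsContPartDensity (μ : Measure ℝ) (ρ : ℝ → ℝ) : Prop :=
  Measurable ρ ∧ (∀ x, 0 ≤ ρ x) ∧
    (volume : Measure ℝ).withDensity (μ.rnDeriv volume) =
      (volume : Measure ℝ).withDensity (fun x => ENNReal.ofReal (ρ x))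

/-- The denominator of the first density. -/
def denom1 (p₀ p x : ℝ) : ℝ := (p - p₀) * x ^ 2 + p₀ ^ 2

/-- The denominator of the second density. -/
def denom2 (p₀ p₁ p x : ℝ) : ℝ :=
  (p - p₁) * x ^ 4 + (p₀ * (p₁ - 2 * p) + p₁ ^ 2) * x ^ 2 + p₀ ^ 2 * p

/-- The denominator of the third density. -/
def denom3 (p₀ p₁ p₂ p x : ℝ) : ℝ :=
  (p - p₂) * x ^ 6
    + ((p₀ + p₁) * (p₂ - 2 * p) + (p₀ + p₂) * p₂) * x ^ 4
    + ((p₀ + p₁) ^ 2 * p - p₀ * p₂ * (p₀ + p₁ + 2 * p₂)) * x ^ 2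
    + p₀ ^ 2 * p₂ ^ 2

/-- `(1 / 2π) · a √(4p - x²) / D x` on the open interval `(-2√p, 2√p)`, zero elsewhere. -/
noncomputable def rho (a p : ℝ) (D : ℝ → ℝ) : ℝ → ℝ :=
  (Set.Ioo (-2 * √p) (2 * √p)).indicator
    (fun x => 1 / (2 * Real.pi) * (a * √(4 * p - x ^ 2) / D x))

/-! Write P_k for the orthogonal polynomials of γ, where γ_k = p for k > K, and U_n for those of the
constant sequence p (rescaled Chebyshev polynomials of the second kind, orthogonal for the
semicircle law). The key object is the Bernstein–Szegő polynomial D = p P_{K+1}² - γ_K x P_{K+1} P_K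
+ γ_K² P_K². The identity P_{K+1} U_{n+1} = P_{K+2+n} + γ_K P_K U_n turns D U_{n+1} into a
combination of products P_i P_j with i ≠ j, so the functional Q ↦ ∫ D Q dμ kills every U_{n+1},
exactly as the semicircle does. Comparing masses, D μ = γ_0 ⋯ γ_K · `semicircle p`
(`HasJacobiCoefficients.withDensity_bernsteinSzego`). Dividing by D off its finitely many zeros
gives the density; the zeros can only carry a singular part
(`HasJacobiCoefficients.isAbsContPartDensity`). Positivity of D on the interval comes from
completing the square. Uniqueness: bounded coefficients make the moments grow geometrically, so the
support is compact and Weierstrass approximation applies. Existence: μ is the spectral measure of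
the Jacobi operator on ℓ² at the first basis vector. -/

/-! ### Recurrences, moment functionals and the Bernstein–Szegő polynomial. -/

section Algebra

theorem jacobiPoly_zero_one (γ : ℕ → ℝ) : jacobiPoly (fun _ => 0) γ 1 = X := by
  simp [jacobiPoly]

theorem jacobiPoly_zero_add_two (γ : ℕ → ℝ) (n : ℕ) :
    jacobiPoly (fun _ => 0) γ (n + 2) =
      X * jacobiPoly (fun _ => 0) γ (n + 1) - C (γ n) * jacobiPoly (fun _ => 0) γ n := by
  simp [jacobiPoly]

/-- A linear functional on polynomials is determined by its values on the orthogonal polynomials. -/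
theorem linearMap_ext_jacobiPoly (γ : ℕ → ℝ) {L M : ℝ[X] →ₗ[ℝ] ℝ}
    (h : ∀ n, L (jacobiPoly (fun _ => 0) γ n) = M (jacobiPoly (fun _ => 0) γ n)) : L = M := by
  -- Strengthened to all n because the recurrence trades one factor X for shifts of the index n.
  have key : ∀ k n, L (X ^ k * jacobiPoly (fun _ => 0) γ n) =
      M (X ^ k * jacobiPoly (fun _ => 0) γ n) := by
    intro k
    induction k with
    | zero => simpa using h
    | succ k ih =>
      rintro (_ | n)
      · have := ih 1
        rw [jacobiPoly_zero_one] at this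
        simpa [jacobiPoly, pow_succ] using this
      · have e : X ^ (k + 1) * jacobiPoly (fun _ => 0) γ (n + 1) =
            X ^ k * jacobiPoly (fun _ => 0) γ (n + 2) +
              γ n • (X ^ k * jacobiPoly (fun _ => 0) γ n) := by
          rw [jacobiPoly_zero_add_two, smul_eq_C_mul]; ring
        rw [e]
        simp [ih]
  ext k
  simpa [jacobiPoly, ← C_mul_X_pow_eq_monomial] using key k 0

/-- If the recurrence coefficients are bounded, the moments grow at most geometrically. -/
theorem abs_moment_le (γ : ℕ → ℝ) {Γ : ℝ} (hΓ : ∀ n, |γ n| ≤ Γ) {L : ℝ[X] →ₗ[ℝ] ℝ}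
    (h0 : L 1 = 1) (h : ∀ n, L (jacobiPoly (fun _ => 0) γ (n + 1)) = 0) (k : ℕ) :
    |L (X ^ k)| ≤ (1 + Γ) ^ k := by
  have hΓ0 : 0 ≤ Γ := (abs_nonneg _).trans (hΓ 0)
  have key : ∀ k n, |L (X ^ k * jacobiPoly (fun _ => 0) γ n)| ≤ (1 + Γ) ^ k := by
    intro k
    induction k with
    | zero =>
      rintro (_ | n)
      · simp [jacobiPoly, h0]
      · simp [h]
    | succ k ih =>
      have hk : (0 : ℝ) ≤ (1 + Γ) ^ k := by positivity
      rintro (_ | n)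
      · have := ih 1
        rw [jacobiPoly_zero_one] at this
        have h2 : |L (X ^ (k + 1) * jacobiPoly (fun _ => 0) γ 0)| ≤ (1 + Γ) ^ k := by
          simpa [jacobiPoly, pow_succ] using this
        refine h2.trans ?_
        rw [pow_succ]
        nlinarith
      · have e : X ^ (k + 1) * jacobiPoly (fun _ => 0) γ (n + 1) =
            X ^ k * jacobiPoly (fun _ => 0) γ (n + 2) +
              γ n • (X ^ k * jacobiPoly (fun _ => 0) γ n) := by
          rw [jacobiPoly_zero_add_two, smul_eq_C_mul]; ring
        rw [e, map_add, map_smul, smul_eq_mul]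
        refine (abs_add_le _ _).trans ?_
        rw [abs_mul, pow_succ]
        have h1 := ih (n + 2)
        have h2 := mul_le_mul (hΓ n) (ih n) (abs_nonneg _) hΓ0
        linarith
  simpa [jacobiPoly] using key k 0

/-- The squared norms of the orthogonal polynomials. -/
theorem functional_jacobiPoly_sq (γ : ℕ → ℝ) {L : ℝ[X] →ₗ[ℝ] ℝ} (h0 : L 1 = 1)
    (h : ∀ m n, m ≠ n → L (jacobiPoly (fun _ => 0) γ m * jacobiPoly (fun _ => 0) γ n) = 0)
    (n : ℕ) :
    L (jacobiPoly (fun _ => 0) γ n * jacobiPoly (fun _ => 0) γ n) =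
      ∏ i ∈ Finset.range n, γ i := by
  induction n with
  | zero => simpa [jacobiPoly] using h0
  | succ n ih =>
    -- L(X P_n P_{n+1}) is computed twice: expanding X P_{n+1} gives γ_n L(P_n²), expanding X P_n
    -- gives L(P_{n+1}²).
    have e : L (X * jacobiPoly (fun _ => 0) γ n * jacobiPoly (fun _ => 0) γ (n + 1)) =
        γ n * ∏ i ∈ Finset.range n, γ i := by
      have : X * jacobiPoly (fun _ => 0) γ n * jacobiPoly (fun _ => 0) γ (n + 1) =
          jacobiPoly (fun _ => 0) γ n * jacobiPoly (fun _ => 0) γ (n + 2) +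
            γ n • (jacobiPoly (fun _ => 0) γ n * jacobiPoly (fun _ => 0) γ n) := by
        rw [jacobiPoly_zero_add_two, smul_eq_C_mul]; ring
      rw [this, map_add, map_smul, ih, h _ _ (by omega), zero_add, smul_eq_mul]
    rw [Finset.prod_range_succ, mul_comm _ (γ n), ← e]
    rcases n with _ | n
    · simp [jacobiPoly]
    · have : jacobiPoly (fun _ => 0) γ (n + 2) * jacobiPoly (fun _ => 0) γ (n + 2) =
          X * jacobiPoly (fun _ => 0) γ (n + 1) * jacobiPoly (fun _ => 0) γ (n + 2) -
            γ n • (jacobiPoly (fun _ => 0) γ n * jacobiPoly (fun _ => 0) γ (n + 2)) := by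
        rw [smul_eq_C_mul]
        nth_rw 1 [jacobiPoly_zero_add_two]
        ring
      rw [this, map_sub, map_smul, h n (n + 2) (by omega), smul_zero, sub_zero]

/-- The Bernstein–Szegő polynomial attached to recurrence coefficients which are equal to `p` from
index `K + 1` on. -/
noncomputable def bernsteinSzego (γ : ℕ → ℝ) (K : ℕ) (p : ℝ) : ℝ[X] :=
  C p * jacobiPoly (fun _ => 0) γ (K + 1) ^ 2
    - C (γ K) * X * jacobiPoly (fun _ => 0) γ (K + 1) * jacobiPoly (fun _ => 0) γ K
    + C (γ K) ^ 2 * jacobiPoly (fun _ => 0) γ K ^ 2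

variable {γ : ℕ → ℝ} {K : ℕ} {p : ℝ}

/-- As functions of n both sides satisfy f_{n+2} = X f_{n+1} - p f_n, because the coefficients
beyond K are p; it remains to compare n = 0 and n = 1. -/
theorem jacobiPoly_mul_const (hγ : ∀ k, K < k → γ k = p) (n : ℕ) :
    jacobiPoly (fun _ => 0) γ (K + 1) * jacobiPoly (fun _ => 0) (fun _ => p) (n + 1) =
      jacobiPoly (fun _ => 0) γ (K + 2 + n) +
        C (γ K) * jacobiPoly (fun _ => 0) γ K * jacobiPoly (fun _ => 0) (fun _ => p) n := by
  induction n using Nat.strong_induction_on with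
  | _ n ih =>
    match n, ih with
    | 0, _ =>
      rw [zero_add, add_zero, jacobiPoly_zero_one, jacobiPoly_zero_add_two]
      simp only [jacobiPoly]
      ring
    | 1, _ =>
      rw [jacobiPoly_zero_add_two, show K + 2 + 1 = (K + 1) + 2 by ring,
        jacobiPoly_zero_add_two γ (K + 1), jacobiPoly_zero_add_two γ K, hγ (K + 1) (by omega),
        zero_add, jacobiPoly_zero_one]
      simp only [jacobiPoly]
      ring
    | n + 2, ih =>
      have h1 := ih n (by omega)
      have h2 := ih (n + 1) (by omega)
      rw [jacobiPoly_zero_add_two _ (n + 1), jacobiPoly_zero_add_two _ n,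
        show K + 2 + (n + 2) = (K + 2 + n) + 2 by ring,
        jacobiPoly_zero_add_two γ (K + 2 + n), hγ (K + 2 + n) (by omega)]
      rw [show K + 2 + (n + 1) = K + 2 + n + 1 by ring, jacobiPoly_zero_add_two _ n] at h2
      linear_combination X * h2 - C p * h1

theorem bernsteinSzego_mul (hγ : ∀ k, K < k → γ k = p) (n : ℕ) :
    bernsteinSzego γ K p * jacobiPoly (fun _ => 0) (fun _ => p) (n + 1) =
      (C p * jacobiPoly (fun _ => 0) γ (K + 1) - C (γ K) * X * jacobiPoly (fun _ => 0) γ K) *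
          jacobiPoly (fun _ => 0) γ (K + 2 + n)
        + C p * C (γ K) * jacobiPoly (fun _ => 0) γ K * jacobiPoly (fun _ => 0) γ (K + 1 + n) := by
  unfold bernsteinSzego
  have h1 := jacobiPoly_mul_const hγ n
  rcases n with _ | n
  · rw [zero_add, add_zero, add_zero, jacobiPoly_zero_one, jacobiPoly_zero_add_two]
    ring
  · have h2 := jacobiPoly_mul_const hγ n
    rw [show K + 1 + (n + 1) = K + 2 + n by ring]
    rw [jacobiPoly_zero_add_two] at *
    linear_combination (C p * jacobiPoly (fun _ => 0) γ (K + 1) -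
      C (γ K) * X * jacobiPoly (fun _ => 0) γ K) * h1 +
      C p * C (γ K) * jacobiPoly (fun _ => 0) γ K * h2

theorem functional_bernsteinSzego_mul (hγ : ∀ k, K < k → γ k = p) {L : ℝ[X] →ₗ[ℝ] ℝ}
    (h : ∀ m n, m ≠ n → L (jacobiPoly (fun _ => 0) γ m * jacobiPoly (fun _ => 0) γ n) = 0)
    (n : ℕ) :
    L (bernsteinSzego γ K p * jacobiPoly (fun _ => 0) (fun _ => p) (n + 1)) = 0 := by
  -- The factor p - γ (K+1+n) vanishes, but this is not needed: each of the three products has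
  -- distinct indices, so `L` kills it.
  have e : bernsteinSzego γ K p * jacobiPoly (fun _ => 0) (fun _ => p) (n + 1) =
      p • (jacobiPoly (fun _ => 0) γ (K + 1) * jacobiPoly (fun _ => 0) γ (K + 2 + n))
      - γ K • (jacobiPoly (fun _ => 0) γ K * jacobiPoly (fun _ => 0) γ (K + 3 + n))
      + (γ K * (p - γ (K + 1 + n))) •
        (jacobiPoly (fun _ => 0) γ K * jacobiPoly (fun _ => 0) γ (K + 1 + n)) := by
    rw [bernsteinSzego_mul hγ, show K + 3 + n = (K + 1 + n) + 2 by ring,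
      jacobiPoly_zero_add_two γ (K + 1 + n), show K + 1 + n + 1 = K + 2 + n by ring]
    simp only [smul_eq_C_mul, C_mul, C_sub]
    ring
  rw [e, map_add, map_sub, map_smul, map_smul, map_smul, h _ _ (by omega), h _ _ (by omega),
    h _ _ (by omega)]
  simp

theorem functional_bernsteinSzego {L : ℝ[X] →ₗ[ℝ] ℝ} (h0 : L 1 = 1)
    (h : ∀ m n, m ≠ n → L (jacobiPoly (fun _ => 0) γ m * jacobiPoly (fun _ => 0) γ n) = 0) :
    L (bernsteinSzego γ K p) = p * ∏ i ∈ Finset.range (K + 1), γ i := by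
  -- Folding the last two terms of D into P_{K+2} leaves one diagonal product, p P_{K+1}².
  have e : bernsteinSzego γ K p =
      p • (jacobiPoly (fun _ => 0) γ (K + 1) * jacobiPoly (fun _ => 0) γ (K + 1))
      - γ K • (jacobiPoly (fun _ => 0) γ K * jacobiPoly (fun _ => 0) γ (K + 2)) := by
    rw [jacobiPoly_zero_add_two γ K, bernsteinSzego]
    simp only [smul_eq_C_mul]
    ring
  rw [e, map_sub, map_smul, map_smul, h K (K + 2) (by omega), functional_jacobiPoly_sq γ h0 h]
  simp

/-- Against the Bernstein–Szegő polynomial, the functional is the one of the coefficients `p`. -/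
theorem functional_bernsteinSzego_eq (hγ : ∀ k, K < k → γ k = p) {L S : ℝ[X] →ₗ[ℝ] ℝ}
    (h0 : L 1 = 1)
    (h : ∀ m n, m ≠ n → L (jacobiPoly (fun _ => 0) γ m * jacobiPoly (fun _ => 0) γ n) = 0)
    (hS0 : S 1 = p) (hS : ∀ n, S (jacobiPoly (fun _ => 0) (fun _ => p) (n + 1)) = 0) (Q : ℝ[X]) :
    L (bernsteinSzego γ K p * Q) = (∏ i ∈ Finset.range (K + 1), γ i) * S Q := by
  have : L ∘ₗ LinearMap.mulLeft ℝ (bernsteinSzego γ K p) =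
      (∏ i ∈ Finset.range (K + 1), γ i) • S := by
    apply linearMap_ext_jacobiPoly (fun _ => p)
    rintro (_ | n)
    · simp [jacobiPoly, hS0, functional_bernsteinSzego h0 h, mul_comm]
    · simp [hS, functional_bernsteinSzego_mul hγ h]
  exact LinearMap.congr_fun this Q

/-- Completing the square in the Bernstein–Szegő polynomial. -/
theorem four_mul_bernsteinSzego_eval (x : ℝ) :
    4 * p * (bernsteinSzego γ K p).eval x =
      (2 * p * (jacobiPoly (fun _ => 0) γ (K + 1)).eval x -
        γ K * x * (jacobiPoly (fun _ => 0) γ K).eval x) ^ 2 +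
      (γ K) ^ 2 * (4 * p - x ^ 2) * (jacobiPoly (fun _ => 0) γ K).eval x ^ 2 := by
  simp [bernsteinSzego]
  ring

/-- Consecutive orthogonal polynomials have no common zero. -/
theorem jacobiPoly_eval_ne_zero (hpos : ∀ k, 0 < γ k) (x : ℝ) (n : ℕ)
    (h : (jacobiPoly (fun _ => 0) γ n).eval x = 0) :
    (jacobiPoly (fun _ => 0) γ (n + 1)).eval x ≠ 0 := by
  induction n with
  | zero => simp [jacobiPoly] at h
  | succ n ih =>
    intro h'
    rw [jacobiPoly_zero_add_two] at h'
    simp only [eval_sub, eval_mul, eval_X, h, mul_zero, eval_C, zero_sub, neg_eq_zero,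
      mul_eq_zero, (hpos n).ne', false_or] at h'
    exact ih h' h

theorem bernsteinSzego_eval_pos (hpos : ∀ k, 0 < γ k) (hp : 0 < p) {x : ℝ}
    (hx : x ^ 2 < 4 * p) : 0 < (bernsteinSzego γ K p).eval x := by
  have e := four_mul_bernsteinSzego_eval (γ := γ) (K := K) (p := p) x
  have hc : 0 < (γ K) ^ 2 * (4 * p - x ^ 2) := mul_pos (pow_pos (hpos K) 2) (by linarith)
  have : 0 < 4 * p * (bernsteinSzego γ K p).eval x := by
    rw [e]
    -- Where P_K vanishes, P_{K+1} does not, and the first square is positive; elsewhere the second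
    -- term is.
    by_cases hB : (jacobiPoly (fun _ => 0) γ K).eval x = 0
    · have hA := jacobiPoly_eval_ne_zero hpos x K hB
      rw [hB]
      have : 2 * p * (jacobiPoly (fun _ => 0) γ (K + 1)).eval x ≠ 0 := by positivity
      simp only [mul_zero, sub_zero]
      positivity
    · positivity
  exact pos_of_mul_pos_right this (by positivity)

end Algebra

/-! ### Chebyshev polynomials and the semicircle measure. -/

section Semicircle

theorem jacobiPoly_const_eval_cos {p : ℝ} (hp : 0 ≤ p) (θ : ℝ) (n : ℕ) :
    (jacobiPoly (fun _ => 0) (fun _ => p) n).eval (2 * √p * Real.cos θ) * Real.sin θ =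
      √p ^ n * Real.sin ((n + 1) * θ) := by
  induction n using Nat.strong_induction_on with
  | _ n ih =>
    match n, ih with
    | 0, _ => simp [jacobiPoly]
    | 1, _ =>
      rw [jacobiPoly_zero_one]
      norm_num [Real.sin_two_mul]
      ring
    | n + 2, ih =>
      have h1 := ih n (by omega)
      have h2 := ih (n + 1) (by omega)
      have hs : √p ^ 2 = p := Real.sq_sqrt hp
      have e1 : ((n + 2 : ℕ) + 1 : ℝ) * θ = ((n + 1 : ℕ) + 1 : ℝ) * θ + θ := by push_cast; ring
      have e2 : ((n : ℕ) + 1 : ℝ) * θ = ((n + 1 : ℕ) + 1 : ℝ) * θ - θ := by push_cast; ring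
      rw [e2, Real.sin_sub] at h1
      rw [e1, Real.sin_add, jacobiPoly_zero_add_two]
      simp only [eval_sub, eval_mul, eval_X, eval_C]
      linear_combination 2 * √p * Real.cos θ * h2 - p * h1 +
        (√p ^ n * (Real.sin (((n + 1 : ℕ) + 1 : ℝ) * θ) * Real.cos θ -
          Real.cos (((n + 1 : ℕ) + 1 : ℝ) * θ) * Real.sin θ)) * hs

theorem integral_mul_sqrt_eq_integral_cos {p : ℝ} (hp : 0 < p) {f : ℝ → ℝ} (hf : Continuous f) :
    ∫ x in (-2 * √p)..(2 * √p), f x * √(4 * p - x ^ 2) =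
      4 * p * ∫ θ in (0 : ℝ)..Real.pi, f (2 * √p * Real.cos θ) * Real.sin θ ^ 2 := by
  have hs : √p ^ 2 = p := Real.sq_sqrt hp.le
  have h := intervalIntegral.integral_comp_mul_deriv (a := 0) (b := Real.pi)
    (f := fun θ => 2 * √p * Real.cos θ) (f' := fun θ => 2 * √p * (-Real.sin θ))
    (g := fun x => f x * √(4 * p - x ^ 2))
    (fun θ _ => (Real.hasDerivAt_cos θ).const_mul _) (by fun_prop) (by fun_prop)
  simp only [Real.cos_zero, Real.cos_pi, mul_one, mul_neg_one] at h
  -- As θ runs from 0 to π, x runs from 2√p down to -2√p; the reversal cancels the sign of the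
  -- derivative of cos.
  rw [intervalIntegral.integral_symm (-(2 * √p)) (2 * √p), ← neg_mul] at h
  have h' := congrArg Neg.neg h
  rw [neg_neg] at h'
  rw [← h', ← intervalIntegral.integral_neg,
    ← intervalIntegral.integral_const_mul]
  refine intervalIntegral.integral_congr fun θ hθ => ?_
  rw [Set.uIcc_of_le Real.pi_pos.le] at hθ
  have hsin := Real.sin_nonneg_of_mem_Icc hθ
  have e : √(4 * p - (2 * √p * Real.cos θ) ^ 2) = 2 * √p * Real.sin θ := by
    rw [← Real.sqrt_sq (show 0 ≤ 2 * √p * Real.sin θ by positivity)]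
    congr 1
    rw [mul_pow, mul_pow, mul_pow, mul_pow, hs]
    linear_combination 4 * p * (Real.sin_sq_add_cos_sq θ).symm
  simp only [Function.comp_apply, e]
  linear_combination 4 * f (2 * √p * Real.cos θ) * Real.sin θ ^ 2 * hs

theorem integral_jacobiPoly_const_succ {p : ℝ} (hp : 0 < p) (n : ℕ) :
    ∫ x in (-2 * √p)..(2 * √p),
      (jacobiPoly (fun _ => 0) (fun _ => p) (n + 1)).eval x * √(4 * p - x ^ 2) = 0 := by
  rw [integral_mul_sqrt_eq_integral_cos hp (Polynomial.continuous _)]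
  -- Product-to-sum for sin((n+2)θ) sin θ: both resulting frequencies are nonzero, so both cosines
  -- integrate to 0 over [0, π].
  have e : ∀ θ : ℝ, (jacobiPoly (fun _ => 0) (fun _ => p) (n + 1)).eval (2 * √p * Real.cos θ) *
      Real.sin θ ^ 2 = √p ^ (n + 1) / 2 *
        (Real.cos (((n + 1 : ℕ) : ℝ) * θ) - Real.cos (((n + 3 : ℕ) : ℝ) * θ)) := by
    intro θ
    have h := jacobiPoly_const_eval_cos hp.le θ (n + 1)
    rw [show ((n + 1 : ℕ) : ℝ) * θ = (((n + 1 : ℕ) : ℝ) + 1) * θ - θ by ring,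
      show ((n + 3 : ℕ) : ℝ) * θ = (((n + 1 : ℕ) : ℝ) + 1) * θ + θ by push_cast; ring,
      Real.cos_sub, Real.cos_add]
    linear_combination Real.sin θ * h
  have hc : ∀ m : ℕ, m ≠ 0 → ∫ θ in (0 : ℝ)..Real.pi, Real.cos ((m : ℝ) * θ) = 0 := by
    intro m hm
    have hm' : (m : ℝ) ≠ 0 := by exact_mod_cast hm
    rw [intervalIntegral.integral_comp_mul_left (fun x => Real.cos x) hm']
    simp
  simp_rw [e]
  rw [intervalIntegral.integral_const_mul, intervalIntegral.integral_sub
    (Continuous.intervalIntegrable (by fun_prop) _ _)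
    (Continuous.intervalIntegrable (by fun_prop) _ _), hc _ (by omega), hc _ (by omega)]
  simp

theorem integral_sqrt_four_mul_sub_sq {p : ℝ} (hp : 0 < p) :
    ∫ x in (-2 * √p)..(2 * √p), √(4 * p - x ^ 2) = 2 * Real.pi * p := by
  have h := integral_mul_sqrt_eq_integral_cos hp (f := fun _ => 1) continuous_const
  simp only [one_mul, integral_sin_sq] at h
  rw [h]
  simp
  ring

/-- The measure `(1 / 2π) √(4p - x²) dx` on `(-2√p, 2√p)`, of total mass `p`. -/
noncomputable def semicircle (p : ℝ) : Measure ℝ :=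
  (volume.restrict (Set.Ioo (-2 * √p) (2 * √p))).withDensity
    fun x => ENNReal.ofReal (1 / (2 * Real.pi) * √(4 * p - x ^ 2))

theorem measurable_semicircle_density (p : ℝ) :
    Measurable fun x : ℝ => 1 / (2 * Real.pi) * √(4 * p - x ^ 2) := by fun_prop

theorem semicircle_compl (p : ℝ) : semicircle p (Set.Icc (-2 * √p) (2 * √p))ᶜ = 0 := by
  apply withDensity_absolutelyContinuous
  rw [Measure.restrict_apply measurableSet_Icc.compl]
  convert measure_empty (μ := volume)
  ext x
  simp only [Set.mem_inter_iff, Set.mem_compl_iff, Set.mem_Icc, Set.mem_Ioo, Set.mem_empty_iff_false,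
    iff_false]
  rintro ⟨h1, h2, h3⟩
  exact h1 ⟨h2.le, h3.le⟩

instance isFiniteMeasure_semicircle (p : ℝ) : IsFiniteMeasure (semicircle p) := by
  apply isFiniteMeasure_withDensity_ofReal
  apply HasFiniteIntegral.mono' (g := fun _ => 1 / (2 * Real.pi) * √(4 * p))
  · exact (integrable_const _).2
  · filter_upwards with x
    rw [Real.norm_of_nonneg (by positivity)]
    gcongr
    nlinarith [sq_nonneg x]

theorem integral_semicircle {p : ℝ} (f : ℝ → ℝ) :
    ∫ x, f x ∂(semicircle p) =
      1 / (2 * Real.pi) * ∫ x in (-2 * √p)..(2 * √p), f x * √(4 * p - x ^ 2) := by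
  rw [semicircle, integral_withDensity_eq_integral_toReal_smul
    (measurable_semicircle_density p).ennreal_ofReal (by simp),
    intervalIntegral.integral_of_le (by linarith [Real.sqrt_nonneg p]), integral_Ioc_eq_integral_Ioo,
    ← integral_const_mul]
  refine integral_congr_ae ?_
  filter_upwards with x
  rw [ENNReal.toReal_ofReal (by positivity), smul_eq_mul]
  ring

end Semicircle

/-! ### Uniqueness of the measure through compact support. -/

section Determinacy

theorem integrable_eval {μ : Measure ℝ} (h : ∀ k : ℕ, Integrable (fun x : ℝ => x ^ k) μ)
    (Q : ℝ[X]) : Integrable (fun x => Q.eval x) μ := by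
  simp_rw [Polynomial.eval_eq_sum_range]
  exact integrable_finsetSum _ fun k _ => (h k).const_mul _

/-- Integration of polynomials. -/
noncomputable def momentFunctional (μ : Measure ℝ)
    (h : ∀ k : ℕ, Integrable (fun x : ℝ => x ^ k) μ) : ℝ[X] →ₗ[ℝ] ℝ where
  toFun Q := ∫ x, Q.eval x ∂μ
  map_add' P Q := by
    simp only [eval_add]
    exact integral_add (integrable_eval h P) (integrable_eval h Q)
  map_smul' c Q := by simp [integral_const_mul]

/-- Geometric growth of the moments bounds the support. -/
theorem measure_compl_Icc_eq_zero {μ : Measure ℝ} [IsFiniteMeasure μ]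
    (h : ∀ k : ℕ, Integrable (fun x : ℝ => x ^ k) μ) {R : ℝ} (hR : 0 ≤ R)
    (hm : ∀ k : ℕ, |∫ x, x ^ k ∂μ| ≤ R ^ k) {S : ℝ} (hS : R < S) :
    μ (Set.Icc (-S) S)ᶜ = 0 := by
  have hS0 : 0 < S := hR.trans_lt hS
  -- Markov's inequality for x^(2k); letting k → ∞ kills the mass outside [-S, S].
  have key : ∀ k : ℕ, μ.real (Set.Icc (-S) S)ᶜ ≤ ((R / S) ^ 2) ^ k := by
    intro k
    have h1 : S ^ (2 * k) * μ.real {x | S ^ (2 * k) ≤ x ^ (2 * k)} ≤ ∫ x, x ^ (2 * k) ∂μ :=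
      mul_meas_ge_le_integral_of_nonneg
        (Filter.Eventually.of_forall fun x => (even_two_mul k).pow_nonneg x) (h (2 * k)) _
    have h2 : μ.real (Set.Icc (-S) S)ᶜ ≤ μ.real {x | S ^ (2 * k) ≤ x ^ (2 * k)} := by
      apply measureReal_mono
      · intro x hx
        have : S ≤ |x| := by
          by_contra! hlt
          exact hx (Set.mem_Icc.2 (abs_le.1 hlt.le))
        rw [Set.mem_ofPred_eq, ← (even_two_mul k).pow_abs x]
        gcongr
      · exact measure_ne_top _ _
    have h3 := (le_abs_self _).trans (hm (2 * k))
    rw [← pow_mul, div_pow, le_div_iff₀ (by positivity), mul_comm]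
    calc S ^ (2 * k) * μ.real (Set.Icc (-S) S)ᶜ
        ≤ S ^ (2 * k) * μ.real {x | S ^ (2 * k) ≤ x ^ (2 * k)} := by gcongr
      _ ≤ R ^ (2 * k) := h1.trans h3
  have h0 : μ.real (Set.Icc (-S) S)ᶜ ≤ 0 := by
    refine ge_of_tendsto' (tendsto_pow_atTop_nhds_zero_of_lt_one (by positivity) ?_) key
    exact pow_lt_one₀ (by positivity) ((div_lt_one hS0).2 hS) two_ne_zero
  exact (measureReal_eq_zero_iff).1 (le_antisymm h0 measureReal_nonneg)

theorem integrable_of_compl_Icc {μ : Measure ℝ} [IsFiniteMeasure μ] {S : ℝ}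
    (hμ : μ (Set.Icc (-S) S)ᶜ = 0) {f : ℝ → ℝ} (hf : Continuous f) : Integrable f μ := by
  have : μ.restrict (Set.Icc (-S) S) = μ := Measure.restrict_eq_self_of_ae_mem hμ
  rw [← this]
  exact hf.continuousOn.integrableOn_compact isCompact_Icc

/-- Compactly supported finite measures are determined by their integrals of polynomials. -/
theorem measure_ext_of_integral_polynomial {μ ν : Measure ℝ} [IsFiniteMeasure μ]
    [IsFiniteMeasure ν] {S : ℝ} (hμ : μ (Set.Icc (-S) S)ᶜ = 0) (hν : ν (Set.Icc (-S) S)ᶜ = 0)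
    (h : ∀ Q : ℝ[X], ∫ x, Q.eval x ∂μ = ∫ x, Q.eval x ∂ν) : μ = ν := by
  apply ext_of_forall_integral_eq_of_IsFiniteMeasure
  intro f
  have bound : ∀ (m : Measure ℝ) [IsFiniteMeasure m], m (Set.Icc (-S) S)ᶜ = 0 →
      ∀ (Q : ℝ[X]) (ε : ℝ), (∀ x ∈ Set.Icc (-S) S, |Q.eval x - f x| < ε) →
        |∫ x, Q.eval x ∂m - ∫ x, f x ∂m| ≤ ε * m.real Set.univ := by
    intro m _ hm Q ε hQ
    rw [← integral_sub (integrable_of_compl_Icc hm Q.continuous)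
      (integrable_of_compl_Icc hm f.continuous)]
    rw [← Real.norm_eq_abs]
    refine norm_integral_le_of_norm_le_const (μ := m) ?_
    filter_upwards [show ∀ᵐ x ∂m, x ∈ Set.Icc (-S) S from hm] with x hx
    exact (hQ x hx).le
  refine eq_of_abs_sub_nonpos (le_of_forall_pos_le_add fun ε hε => ?_)
  rw [zero_add]
  -- The summand 1 keeps c positive even if both measures vanish.
  set c := μ.real Set.univ + ν.real Set.univ + 1
  have hc0 : 0 < c := by positivity
  obtain ⟨Q, hQ⟩ := exists_polynomial_near_of_continuousOn (-S) S f f.continuous.continuousOn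
    (ε / c) (by positivity)
  have h1 := bound μ hμ Q _ hQ
  have h2 := bound ν hν Q _ hQ
  rw [h Q] at h1
  have h3 : ε / c * μ.real Set.univ + ε / c * ν.real Set.univ ≤ ε := by
    rw [← mul_add, div_mul_eq_mul_div, div_le_iff₀ hc0]
    gcongr
    linarith
  calc |∫ x, f x ∂μ - ∫ x, f x ∂ν|
      = |(∫ x, Q.eval x ∂ν - ∫ x, f x ∂ν) - (∫ x, Q.eval x ∂ν - ∫ x, f x ∂μ)| := by
        congr 1; ring
    _ ≤ _ := (abs_sub _ _).trans (by linarith)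

theorem HasJacobiCoefficients.momentFunctional_one {μ : Measure ℝ} [IsProbabilityMeasure μ]
    {β γ : ℕ → ℝ} (h : HasJacobiCoefficients μ β γ) :
    momentFunctional μ h.integrable_pow 1 = 1 := by
  simp [momentFunctional]

theorem HasJacobiCoefficients.momentFunctional_mul {μ : Measure ℝ}
    {β γ : ℕ → ℝ} (h : HasJacobiCoefficients μ β γ) {m n : ℕ} (hmn : m ≠ n) :
    momentFunctional μ h.integrable_pow (jacobiPoly β γ m * jacobiPoly β γ n) = 0 := by
  simpa [momentFunctional] using h.orthogonal m n hmn

theorem HasJacobiCoefficients.momentFunctional_succ {μ : Measure ℝ}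
    {β γ : ℕ → ℝ} (h : HasJacobiCoefficients μ β γ) (n : ℕ) :
    momentFunctional μ h.integrable_pow (jacobiPoly β γ (n + 1)) = 0 := by
  simpa [jacobiPoly] using h.momentFunctional_mul (m := 0) (n := n + 1) (by omega)

theorem HasJacobiCoefficients.measure_compl_Icc {μ : Measure ℝ} [IsProbabilityMeasure μ]
    {γ : ℕ → ℝ} (h : HasJacobiCoefficients μ (fun _ => 0) γ) {Γ : ℝ} (hΓ : ∀ n, |γ n| ≤ Γ) {S : ℝ}
    (hS : 1 + Γ < S) : μ (Set.Icc (-S) S)ᶜ = 0 := by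
  have hΓ0 : 0 ≤ Γ := (abs_nonneg _).trans (hΓ 0)
  refine measure_compl_Icc_eq_zero h.integrable_pow (by positivity) (fun k => ?_) hS
  simpa [momentFunctional] using
    abs_moment_le γ hΓ h.momentFunctional_one h.momentFunctional_succ k

theorem HasJacobiCoefficients.unique {μ ν : Measure ℝ} [IsProbabilityMeasure μ]
    [IsProbabilityMeasure ν] {γ : ℕ → ℝ} {Γ : ℝ} (hΓ : ∀ n, |γ n| ≤ Γ)
    (hμ : HasJacobiCoefficients μ (fun _ => 0) γ) (hν : HasJacobiCoefficients ν (fun _ => 0) γ) :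
    μ = ν := by
  refine measure_ext_of_integral_polynomial (hμ.measure_compl_Icc hΓ (lt_add_one _))
    (hν.measure_compl_Icc hΓ (lt_add_one _)) fun Q => ?_
  have : momentFunctional μ hμ.integrable_pow = momentFunctional ν hν.integrable_pow := by
    apply linearMap_ext_jacobiPoly γ
    rintro (_ | n)
    · exact hμ.momentFunctional_one.trans hν.momentFunctional_one.symm
    · rw [hμ.momentFunctional_succ, hν.momentFunctional_succ]
  exact LinearMap.congr_fun this Q

end Determinacy

/-! ### Existence through the spectral theorem for Jacobi operators. -/

section Existence

open scoped ContinuousMap CompactlySupported InnerProductSpace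

/-- The spectral measure of a bounded self-adjoint operator at a unit vector. -/
theorem exists_spectralMeasure {H : Type*} [NormedAddCommGroup H] [InnerProductSpace ℂ H]
    [CompleteSpace H] (T : H →L[ℂ] H) (hT : IsSelfAdjoint T) {e : H} (he : ‖e‖ = 1) :
    ∃ μ : Measure ℝ, IsProbabilityMeasure μ ∧ (∀ k : ℕ, Integrable (fun x : ℝ => x ^ k) μ) ∧
      ∀ Q : ℝ[X], ∫ x, Q.eval x ∂μ = (⟪e, aeval T Q e⟫_ℂ).re := by
  have hcompact : CompactSpace (spectrum ℝ T) :=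
    isCompact_iff_compactSpace.1 (ContinuousFunctionalCalculus.isCompact_spectrum T)
  let Φ : C(spectrum ℝ T, ℝ) →⋆ₐ[ℝ] (H →L[ℂ] H) := cfcHom hT
  -- Writing f = g* g with g = √f gives ⟨e, Φ(f) e⟩ = ‖Φ(g) e‖². This positivity is what
  -- Riesz–Markov–Kakutani requires.
  have hnonneg : ∀ f : C(spectrum ℝ T, ℝ), (∀ x, 0 ≤ f x) → 0 ≤ (⟪e, Φ f e⟫_ℂ).re := by
    intro f hf
    let g : C(spectrum ℝ T, ℝ) := ⟨fun x => √(f x), by fun_prop⟩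
    have hg : f = star g * g := by
      ext x
      simp [g, Real.mul_self_sqrt (hf x)]
    rw [hg, map_mul, map_star, ContinuousLinearMap.star_eq_adjoint,
      mul_apply_eq_comp, ContinuousLinearMap.adjoint_inner_right]
    exact inner_self_nonneg (𝕜 := ℂ)
  let Λ : C_c(spectrum ℝ T, ℝ) →ₚ[ℝ] ℝ :=
  { toFun f := (⟪e, Φ f.toContinuousMap e⟫_ℂ).re
    map_add' f g := by
      have : (f + g).toContinuousMap = f.toContinuousMap + g.toContinuousMap := rfl
      simp [this]
    map_smul' c f := by
      have : (c • f).toContinuousMap = c • f.toContinuousMap := rfl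
      simp [this, inner_smul_right_eq_smul]
    monotone' f g hfg := by
      have h := hnonneg (g.toContinuousMap - f.toContinuousMap)
        (fun x => sub_nonneg.2 (hfg x))
      simpa [inner_sub_right] using h }
  let ν := RealRMK.rieszMeasure Λ
  have hint : ∀ f : C(spectrum ℝ T, ℝ), ∫ x, f x ∂ν = (⟪e, Φ f e⟫_ℂ).re := fun f =>
    RealRMK.integral_rieszMeasure Λ ⟨f, HasCompactSupport.of_compactSpace f⟩
  have hintQ : ∀ Q : ℝ[X], ∫ x : spectrum ℝ T, Q.eval (x : ℝ) ∂ν = (⟪e, aeval T Q e⟫_ℂ).re := by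
    intro Q
    have h1 : Φ (Q.toContinuousMapOn (spectrum ℝ T)) = aeval T Q := by
      have h2 : Q.toContinuousMapOn (spectrum ℝ T) =
          aeval ((ContinuousMap.id ℝ).restrict (spectrum ℝ T)) Q := by
        ext x
        simp [Polynomial.aeval_continuousMap_apply]
      rw [h2, ← StarAlgHom.coe_toAlgHom, ← Polynomial.aeval_algHom_apply]
      congr 2
      exact cfcHom_id hT
    rw [← h1, ← hint]
    rfl
  have hmeas : Measurable (Subtype.val : spectrum ℝ T → ℝ) := measurable_subtype_coe
  have hmapQ : ∀ Q : ℝ[X], ∫ x, Q.eval x ∂(ν.map Subtype.val) = (⟪e, aeval T Q e⟫_ℂ).re := by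
    intro Q
    rw [integral_map hmeas.aemeasurable Q.continuous.aestronglyMeasurable, hintQ]
  refine ⟨ν.map Subtype.val, ?_, fun k => ?_, hmapQ⟩
  · have : IsFiniteMeasure ν := by infer_instance
    have h1 := hmapQ 1
    simp [he] at h1
    constructor
    have h2 : ((ν.map Subtype.val).real Set.univ) = 1 := by
      simpa [Measure.real, Measure.map_apply hmeas MeasurableSet.univ] using h1
    rw [Measure.real, ENNReal.toReal_eq_one_iff] at h2
    exact h2
  · rw [integrable_map_measure (by fun_prop) hmeas.aemeasurable]
    have : Continuous ((fun x : ℝ => x ^ k) ∘ (Subtype.val : spectrum ℝ T → ℝ)) := by fun_prop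
    exact this.integrable_of_hasCompactSupport (HasCompactSupport.of_compactSpace _)

/-- The weighted left shift on `ℓ²`. -/
theorem exists_weightedShift (w : ℕ → ℝ) {C : ℝ} (hC : ∀ n, |w n| ≤ C) :
    ∃ A : lp (fun _ : ℕ => ℂ) 2 →L[ℂ] lp (fun _ : ℕ => ℂ) 2,
      ∀ x n, A x n = w n * x (n + 1) := by
  have hC0 : 0 ≤ C := (abs_nonneg _).trans (hC 0)
  have hpt : ∀ (x : ℕ → ℂ) (n : ℕ), ‖(w n : ℂ) * x (n + 1)‖ ^ (2 : ℝ) ≤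
      C ^ 2 * ‖x (n + 1)‖ ^ (2 : ℝ) := by
    intro x n
    rw [norm_mul, Complex.norm_real, Real.norm_eq_abs, Real.rpow_two, Real.rpow_two, mul_pow]
    gcongr
    exact hC n
  have hsum : ∀ x : lp (fun _ : ℕ => ℂ) 2, Summable fun n => ‖x (n + 1)‖ ^ (2 : ℝ) := by
    intro x
    have := (lp.memℓp x).summable (by norm_num)
    simp only [ENNReal.toReal_ofNat] at this
    exact this.comp_injective (add_left_injective 1)
  have hmem : ∀ x : lp (fun _ : ℕ => ℂ) 2,
      Memℓp (fun n => (w n : ℂ) * x (n + 1)) 2 := by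
    intro x
    refine memℓp_gen ?_
    simp only [ENNReal.toReal_ofNat]
    exact Summable.of_nonneg_of_le (fun n => by positivity) (hpt x) ((hsum x).mul_left _)
  let A₀ : lp (fun _ : ℕ => ℂ) 2 →ₗ[ℂ] lp (fun _ : ℕ => ℂ) 2 :=
  { toFun x := ⟨fun n => (w n : ℂ) * x (n + 1), hmem x⟩
    map_add' x y := by
      ext n
      exact mul_add _ _ _
    map_smul' c x := by
      ext n
      simp [mul_left_comm] }
  refine ⟨A₀.mkContinuous C fun x => ?_, fun x n => rfl⟩
  refine lp.norm_le_of_forall_sum_le (by norm_num) (by positivity) fun s => ?_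
  simp only [ENNReal.toReal_ofNat]
  calc ∑ i ∈ s, ‖A₀ x i‖ ^ (2 : ℝ) ≤ ∑ i ∈ s, C ^ 2 * ‖x (i + 1)‖ ^ (2 : ℝ) :=
        Finset.sum_le_sum fun n _ => hpt x n
    _ = C ^ 2 * ∑ i ∈ s.map (addRightEmbedding 1), ‖x i‖ ^ (2 : ℝ) := by
        simp [Finset.mul_sum]
    _ ≤ C ^ 2 * ‖x‖ ^ (2 : ℝ) := by
        gcongr
        have := lp.sum_rpow_le_norm_rpow (p := 2) (by norm_num) x (s.map (addRightEmbedding 1))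
        simpa only [ENNReal.toReal_ofNat] using this
    _ = (C * ‖x‖) ^ (2 : ℝ) := by
        rw [Real.rpow_two, Real.rpow_two, mul_pow]

/-- The Jacobi operator with bounded coefficients on `ℓ²`. -/
theorem exists_jacobiOperator (w : ℕ → ℝ) {C : ℝ} (hC : ∀ n, |w n| ≤ C) :
    ∃ J : lp (fun _ : ℕ => ℂ) 2 →L[ℂ] lp (fun _ : ℕ => ℂ) 2, IsSelfAdjoint J ∧
      J (lp.single 2 0 1) = (w 0 : ℂ) • lp.single 2 1 (1 : ℂ) ∧
      ∀ n, J (lp.single 2 (n + 1) 1) =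
        (w n : ℂ) • lp.single 2 n (1 : ℂ) + (w (n + 1) : ℂ) • lp.single 2 (n + 2) (1 : ℂ) := by
  obtain ⟨A, hA⟩ := exists_weightedShift w hC
  have hA0 : A (lp.single 2 0 1) = 0 := by
    ext n
    simp [hA, lp.single_apply]
  have hA1 : ∀ n, A (lp.single 2 (n + 1) 1) = (w n : ℂ) • lp.single 2 n (1 : ℂ) := by
    intro n
    ext m
    by_cases h : m = n
    · subst h
      rw [lp.coeFn_smul, Pi.smul_apply]
      simp [hA]
    · rw [lp.coeFn_smul, Pi.smul_apply]
      simp [hA, lp.single_apply, h]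
  -- The adjoint of the weighted left shift is the weighted right shift, so A + A* is the
  -- tridiagonal Jacobi matrix with zero diagonal.
  have hadj : ∀ n, ContinuousLinearMap.adjoint A (lp.single 2 n 1) =
      (w n : ℂ) • lp.single 2 (n + 1) (1 : ℂ) := by
    intro n
    refine ext_inner_right ℂ fun x => ?_
    rw [ContinuousLinearMap.adjoint_inner_left, inner_smul_left, lp.inner_single_left,
      lp.inner_single_left, hA]
    simp [mul_comm]
  refine ⟨A + star A, IsSelfAdjoint.add_star_self A, ?_, fun n => ?_⟩ <;>
    rw [ContinuousLinearMap.star_eq_adjoint, add_apply, hadj]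
  · rw [hA0, zero_add]
  · rw [hA1]

/-- A Jacobi operator on a Hilbert space maps the first basis vector to the other ones. -/
theorem aeval_jacobiPoly_apply {H : Type*} [NormedAddCommGroup H] [InnerProductSpace ℂ H]
    (J : H →L[ℂ] H) (e : ℕ → H) {γ w : ℕ → ℝ} (hw : ∀ n, w n ^ 2 = γ n)
    (h0 : J (e 0) = (w 0 : ℂ) • e 1)
    (h1 : ∀ n, J (e (n + 1)) = (w n : ℂ) • e n + (w (n + 1) : ℂ) • e (n + 2)) (n : ℕ) :
    aeval J (jacobiPoly (fun _ => 0) γ n) (e 0) =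
      ((∏ i ∈ Finset.range n, w i : ℝ) : ℂ) • e n := by
  induction n using Nat.strong_induction_on with
  | _ n ih =>
    match n, ih with
    | 0, _ => simp [jacobiPoly]
    | 1, _ => simp [jacobiPoly_zero_one, h0]
    | n + 2, ih =>
      have e1 := ih n (by omega)
      have e2 := ih (n + 1) (by omega)
      have hc : ∀ x : H, aeval J (C (γ n)) x = (γ n : ℂ) • x := fun x => by
        rw [aeval_C, Algebra.algebraMap_eq_smul_one, smul_apply,
          one_apply_eq_self, Complex.coe_smul]
      rw [jacobiPoly_zero_add_two, map_sub, map_mul, map_mul, sub_apply,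
        mul_apply_eq_comp, mul_apply_eq_comp, aeval_X, e1, e2, hc, map_smul, h1, ← hw n]
      simp only [Finset.prod_range_succ]
      push_cast
      module

/-- Since P_n(J) is self-adjoint and P_n(J) e_0 is a multiple of e_n, the integral of P_m P_n is
⟨P_m(J) e_0, P_n(J) e_0⟩, and orthonormality of the e_n does the rest. The off-diagonal entries are
w_n with w_n² = γ_n. -/
theorem exists_hasJacobiCoefficients_of_operator {H : Type*} [NormedAddCommGroup H]
    [InnerProductSpace ℂ H] [CompleteSpace H] (J : H →L[ℂ] H) (hJ : IsSelfAdjoint J) {e : ℕ → H}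
    (he : Orthonormal ℂ e) {γ w : ℕ → ℝ} (hw : ∀ n, w n ^ 2 = γ n) (hw0 : ∀ n, w n ≠ 0)
    (h0 : J (e 0) = (w 0 : ℂ) • e 1)
    (h1 : ∀ n, J (e (n + 1)) = (w n : ℂ) • e n + (w (n + 1) : ℂ) • e (n + 2)) :
    ∃ μ : Measure ℝ, IsProbabilityMeasure μ ∧ HasJacobiCoefficients μ (fun _ => 0) γ := by
  obtain ⟨μ, hμ, hint, hQ⟩ := exists_spectralMeasure J hJ (he.1 0)
  have hP := aeval_jacobiPoly_apply J e hw h0 h1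
  have hself : ∀ Q : ℝ[X], IsSelfAdjoint (aeval J Q) := by
    intro Q
    induction Q using Polynomial.induction_on with
    | C a =>
      rw [aeval_C]
      exact IsSelfAdjoint.algebraMap _ (IsSelfAdjoint.all a)
    | add p q hp hq => simpa using hp.add hq
    | monomial n a _ =>
      rw [← smul_eq_C_mul, map_smul, map_pow, aeval_X]
      exact (IsSelfAdjoint.all a).smul (hJ.pow _)
  have hprod : ∀ m n, ∫ x, (jacobiPoly (fun _ => 0) γ m).eval x *
      (jacobiPoly (fun _ => 0) γ n).eval x ∂μ =
        if m = n then (∏ i ∈ Finset.range n, w i) ^ 2 else 0 := by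
    intro m n
    have h1 := hQ (jacobiPoly (fun _ => 0) γ m * jacobiPoly (fun _ => 0) γ n)
    simp only [eval_mul] at h1
    rw [h1, map_mul, mul_apply_eq_comp, hP n,
      ← (hself _).adjoint_eq, ContinuousLinearMap.adjoint_inner_right, hP m,
      inner_smul_left, inner_smul_right, orthonormal_iff_ite.1 he]
    split_ifs with h
    · subst h
      rw [mul_one, Complex.conj_ofReal, ← Complex.ofReal_mul, Complex.ofReal_re, sq]
    · simp
  refine ⟨μ, hμ, hint, fun m n hmn => ?_, fun n => ?_⟩
  · rw [hprod, if_neg hmn]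
  · simp_rw [sq]
    rw [hprod, if_pos rfl]
    have : ∏ i ∈ Finset.range n, w i ≠ 0 := Finset.prod_ne_zero_iff.2 fun i _ => hw0 i
    positivity

/-- Bounded positive coefficients are the Jacobi coefficients of a probability measure. -/
theorem exists_hasJacobiCoefficients {γ : ℕ → ℝ} {Γ : ℝ} (hΓ : ∀ n, γ n ≤ Γ)
    (hpos : ∀ n, 0 < γ n) :
    ∃ μ : Measure ℝ, IsProbabilityMeasure μ ∧ HasJacobiCoefficients μ (fun _ => 0) γ := by
  obtain ⟨J, hJ, h0, h1⟩ := exists_jacobiOperator (fun n => √(γ n)) (C := √Γ) fun n => by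
    rw [abs_of_nonneg (Real.sqrt_nonneg _)]
    exact Real.sqrt_le_sqrt (hΓ n)
  refine exists_hasJacobiCoefficients_of_operator J hJ (e := fun n => lp.single 2 n (1 : ℂ)) ?_
    (fun n => Real.sq_sqrt (hpos n).le) (fun n => (Real.sqrt_pos.2 (hpos n)).ne') h0 h1
  rw [orthonormal_iff_ite]
  intro i j
  rw [lp.inner_single_left, lp.single_apply, Pi.single_apply]
  split_ifs <;> simp

end Existence

/-! ### From the identity D μ = const · semicircle to the density. -/

section Density

variable {γ : ℕ → ℝ} {K : ℕ} {p Γ : ℝ} {μ : Measure ℝ}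

theorem integral_withDensity_ofReal {μ : Measure ℝ} {g : ℝ → ℝ} (hg : Measurable g) (f : ℝ → ℝ) :
    ∫ x, f x ∂(μ.withDensity fun x => ENNReal.ofReal (g x)) = ∫ x, max (g x) 0 * f x ∂μ := by
  rw [integral_withDensity_eq_integral_toReal_smul hg.ennreal_ofReal (by simp)]
  simp [ENNReal.toReal_ofReal']

/-- A polynomial multiple of one measure agrees with a second measure as soon as the
integrals of polynomials do. -/
theorem withDensity_polynomial_eq [IsFiniteMeasure μ] {σ : Measure ℝ} [IsFiniteMeasure σ] {S : ℝ}
    (hμ : μ (Set.Icc (-S) S)ᶜ = 0) (hσ : σ (Set.Icc (-S) S)ᶜ = 0) (D : ℝ[X])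
    (h : ∀ Q : ℝ[X], ∫ x, (D * Q).eval x ∂μ = ∫ x, Q.eval x ∂σ) :
    (∀ᵐ x ∂μ, 0 ≤ D.eval x) ∧ μ.withDensity (fun x => ENNReal.ofReal (D.eval x)) = σ := by
  have hD : Measurable fun x => D.eval x := D.continuous.measurable
  have hfin : ∀ E : ℝ[X], IsFiniteMeasure (μ.withDensity fun x => ENNReal.ofReal (E.eval x)) :=
    fun E => isFiniteMeasure_withDensity_ofReal (integrable_of_compl_Icc hμ E.continuous).2
  have hnull : ∀ E : ℝ[X],
      (μ.withDensity fun x => ENNReal.ofReal (E.eval x)) (Set.Icc (-S) S)ᶜ = 0 :=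
    fun E => withDensity_absolutelyContinuous _ _ hμ
  have := hfin D
  have := hfin (-D)
  -- The sign of D on the support of μ is not yet known and `ENNReal.ofReal` truncates, so the
  -- negative part moves to the other side: D⁺μ = D⁻μ + σ.
  have hadd : μ.withDensity (fun x => ENNReal.ofReal (D.eval x)) =
      μ.withDensity (fun x => ENNReal.ofReal ((-D).eval x)) + σ := by
    refine measure_ext_of_integral_polynomial (hnull D)
      (by rw [Measure.add_apply, hnull, hσ, add_zero]) fun Q => ?_
    rw [integral_add_measure (integrable_of_compl_Icc (hnull _) Q.continuous)
      (integrable_of_compl_Icc hσ Q.continuous), ← h,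
      integral_withDensity_ofReal hD, integral_withDensity_ofReal (-D).continuous.measurable,
      ← integral_add]
    · refine integral_congr_ae (Filter.Eventually.of_forall fun x => ?_)
      simp only [eval_neg, eval_mul]
      rcases le_total 0 (D.eval x) with hx | hx
      · rw [max_eq_left hx, max_eq_right (neg_nonpos.2 hx)]
        ring
      · rw [max_eq_right hx, max_eq_left (neg_nonneg.2 hx)]
        ring
    · exact integrable_of_compl_Icc hμ (by fun_prop)
    · exact integrable_of_compl_Icc hμ (by fun_prop)
  have hmeas : MeasurableSet {x | D.eval x < 0} := measurableSet_lt hD measurable_const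
  -- On {D < 0} the left side of `hadd` has no mass, hence neither does D⁻μ, which forces μ{D < 0} =
  -- 0.
  have h0 : ∀ᵐ x ∂μ, 0 ≤ D.eval x := by
    have h1 : (μ.withDensity (fun x => ENNReal.ofReal (D.eval x))) {x | D.eval x < 0} = 0 := by
      rw [withDensity_apply _ hmeas]
      refine setLIntegral_eq_zero hmeas fun x hx => ?_
      exact ENNReal.ofReal_of_nonpos (le_of_lt hx)
    rw [hadd, Measure.add_apply, add_eq_zero,
      withDensity_apply_eq_zero (-D).continuous.measurable.ennreal_ofReal] at h1
    rw [ae_iff]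
    convert h1.1 using 2
    ext x
    simp
  refine ⟨h0, ?_⟩
  have h2 : μ.withDensity (fun x => ENNReal.ofReal ((-D).eval x)) = 0 := by
    rw [withDensity_eq_zero_iff (-D).continuous.measurable.ennreal_ofReal.aemeasurable]
    filter_upwards [h0] with x hx
    simpa using hx
  rw [hadd, h2, zero_add]

theorem HasJacobiCoefficients.withDensity_bernsteinSzego [IsProbabilityMeasure μ]
    (h : HasJacobiCoefficients μ (fun _ => 0) γ) (hpos : ∀ k, 0 < γ k) (hΓ : ∀ k, γ k ≤ Γ)
    (hγ : ∀ k, K < k → γ k = p) :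
    (∀ᵐ x ∂μ, 0 ≤ (bernsteinSzego γ K p).eval x) ∧
      μ.withDensity (fun x => ENNReal.ofReal ((bernsteinSzego γ K p).eval x)) =
        ENNReal.ofReal (∏ i ∈ Finset.range (K + 1), γ i) • semicircle p := by
  have hp : 0 < p := hγ (K + 1) (by omega) ▸ hpos (K + 1)
  have hprod : 0 < ∏ i ∈ Finset.range (K + 1), γ i := Finset.prod_pos fun i _ => hpos i
  have hsc : ∀ S, 2 * √p ≤ S → semicircle p (Set.Icc (-S) S)ᶜ = 0 := fun S hS =>
    measure_mono_null (Set.compl_subset_compl.2 (Set.Icc_subset_Icc (by linarith) hS))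
      (semicircle_compl p)
  have hscint : ∀ k : ℕ, Integrable (fun x : ℝ => x ^ k) (semicircle p) := fun k =>
    integrable_of_compl_Icc (hsc _ le_rfl) (by fun_prop)
  have : IsFiniteMeasure (ENNReal.ofReal (∏ i ∈ Finset.range (K + 1), γ i) • semicircle p) :=
    Measure.smul_finite _ ENNReal.ofReal_ne_top
  -- One interval containing both supports: any S > 1 + Γ serves for μ, any S ≥ 2√p for the
  -- semicircle.
  refine withDensity_polynomial_eq (S := max (2 + Γ) (2 * √p)) ?_ ?_ _ fun Q => ?_
  · refine measure_mono_null ?_ (h.measure_compl_Icc (Γ := Γ) (S := 2 + Γ) (fun n => ?_) ?_)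
    · exact Set.compl_subset_compl.2
        (Set.Icc_subset_Icc (neg_le_neg (le_max_left _ _)) (le_max_left _ _))
    · rw [abs_of_pos (hpos n)]
      exact hΓ n
    · linarith
  · rw [Measure.smul_apply, hsc _ (le_max_right _ _), smul_zero]
  · rw [integral_smul_measure, ENNReal.toReal_ofReal hprod.le]
    refine functional_bernsteinSzego_eq hγ (L := momentFunctional μ h.integrable_pow)
      (S := momentFunctional (semicircle p) hscint) h.momentFunctional_one
      (fun m n => h.momentFunctional_mul) ?_ (fun n => ?_) Q
    · simp only [momentFunctional, LinearMap.coe_mk, AddHom.coe_mk, eval_one]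
      rw [integral_semicircle]
      simp only [one_mul, integral_sqrt_four_mul_sub_sq hp]
      field_simp
    · simp only [momentFunctional, LinearMap.coe_mk, AddHom.coe_mk]
      rw [integral_semicircle, integral_jacobiPoly_const_succ hp, mul_zero]

theorem sq_lt_four_mul {x : ℝ} (hp : 0 ≤ p) (hx : x ∈ Set.Ioo (-2 * √p) (2 * √p)) :
    x ^ 2 < 4 * p := by
  have hs : √p ^ 2 = p := Real.sq_sqrt hp
  have := sq_lt_sq' (by linarith [hx.1]) hx.2
  rw [mul_pow, hs] at this
  linarith

theorem measurable_rho (a p : ℝ) {D : ℝ → ℝ} (hD : Measurable D) : Measurable (rho a p D) := by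
  unfold rho
  exact Measurable.indicator (by fun_prop) measurableSet_Ioo

/-- Dividing the semicircle by a polynomial gives the density `rho`. -/
theorem semicircle_withDensity_inv {a : ℝ} (ha : 0 ≤ a) {D : ℝ → ℝ} (hD : Measurable D)
    (hpos : ∀ x ∈ Set.Ioo (-2 * √p) (2 * √p), 0 < D x) :
    (ENNReal.ofReal a • semicircle p).withDensity (fun x => (ENNReal.ofReal (D x))⁻¹) =
      volume.withDensity fun x => ENNReal.ofReal (rho a p D x) := by
  have hDi : Measurable fun x => (ENNReal.ofReal (D x))⁻¹ := hD.ennreal_ofReal.inv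
  rw [withDensity_smul_measure, semicircle, ← withDensity_mul _
    (measurable_semicircle_density p).ennreal_ofReal hDi,
    ← withDensity_smul _ ((measurable_semicircle_density p).ennreal_ofReal.mul hDi), ← withDensity_indicator measurableSet_Ioo]
  congr 1
  ext x
  unfold rho
  by_cases hx : x ∈ Set.Ioo (-2 * √p) (2 * √p)
  · rw [Set.indicator_of_mem hx, Set.indicator_of_mem hx]
    have := hpos x hx
    simp only [Pi.smul_apply, Pi.mul_apply, smul_eq_mul]
    rw [← ENNReal.ofReal_inv_of_pos (hpos x hx), ← ENNReal.ofReal_mul (by positivity),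
      ← ENNReal.ofReal_mul ha]
    congr 1
    field_simp
  · rw [Set.indicator_of_notMem hx, Set.indicator_of_notMem hx, ENNReal.ofReal_zero]

theorem HasJacobiCoefficients.isAbsContPartDensity [IsProbabilityMeasure μ]
    (h : HasJacobiCoefficients μ (fun _ => 0) γ) (hpos : ∀ k, 0 < γ k) (hΓ : ∀ k, γ k ≤ Γ)
    (hγ : ∀ k, K < k → γ k = p) :
    IsAbsContPartDensity μ
      (rho (∏ i ∈ Finset.range (K + 1), γ i) p fun x => (bernsteinSzego γ K p).eval x) := by
  have hp : 0 < p := hγ (K + 1) (by omega) ▸ hpos (K + 1)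
  have hprod : 0 < ∏ i ∈ Finset.range (K + 1), γ i := Finset.prod_pos fun i _ => hpos i
  obtain ⟨h0, hden⟩ := h.withDensity_bernsteinSzego hpos hΓ hγ
  set D := bernsteinSzego γ K p
  have hD : Measurable fun x => D.eval x := D.continuous.measurable
  have hDi : Measurable fun x => (ENNReal.ofReal (D.eval x))⁻¹ := hD.ennreal_ofReal.inv
  have hDpos : ∀ x ∈ Set.Ioo (-2 * √p) (2 * √p), 0 < D.eval x := fun x hx =>
    bernsteinSzego_eval_pos hpos hp (sq_lt_four_mul hp.le hx)
  have hrho := measurable_rho (∏ i ∈ Finset.range (K + 1), γ i) p hD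
  have hZ : {x | D.eval x = 0}.Finite := by
    have hD0 : D ≠ 0 := by
      intro hD0
      have := hDpos 0 (by constructor <;> simp [hp])
      simp [hD0] at this
    exact (D.roots.toFinset.finite_toSet).subset fun x hx => by
      simpa [hD0] using hx
  have hposset : MeasurableSet {x | 0 < D.eval x} := measurableSet_lt measurable_const hD
  -- Since D ≥ 0 almost everywhere for μ, off its zeros multiplying by D and then by D⁻¹ recovers μ.
  have hres : μ.restrict {x | D.eval x = 0}ᶜ =
      volume.withDensity fun x =>
        ENNReal.ofReal (rho (∏ i ∈ Finset.range (K + 1), γ i) p (fun x => D.eval x) x) := by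
    rw [← semicircle_withDensity_inv hprod.le hD hDpos, ← hden,
      ← withDensity_mul _ hD.ennreal_ofReal hDi]
    have e1 : μ.restrict {x | D.eval x = 0}ᶜ = μ.restrict {x | 0 < D.eval x} := by
      refine Measure.restrict_congr_set ?_
      filter_upwards [h0] with x hx
      exact propext (show D.eval x ≠ 0 ↔ 0 < D.eval x from hx.lt_iff_ne'.symm)
    rw [e1, ← withDensity_indicator_one hposset]
    congr 1
    ext x
    by_cases hx : 0 < D.eval x
    · rw [Set.indicator_of_mem (show x ∈ {x | 0 < D.eval x} from hx), Pi.mul_apply,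
        ENNReal.mul_inv_cancel (by simpa using hx) ENNReal.ofReal_ne_top, Pi.one_apply]
    · rw [Set.indicator_of_notMem (show x ∉ {x | 0 < D.eval x} from hx), Pi.mul_apply,
        ENNReal.ofReal_of_nonpos (not_lt.1 hx), zero_mul]
  have hsing : μ.restrict {x | D.eval x = 0} ⟂ₘ volume := by
    refine ⟨{x | D.eval x = 0}ᶜ, hZ.measurableSet.compl, ?_, ?_⟩
    · rw [Measure.restrict_apply hZ.measurableSet.compl, Set.compl_inter_self, measure_empty]
    · rw [compl_compl]
      exact hZ.measure_zero _
  refine ⟨hrho, fun x => ?_, ?_⟩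
  · refine Set.indicator_nonneg (fun x hx => ?_) x
    have := hDpos x hx
    positivity
  -- Splitting μ along the zero set of D is its Lebesgue decomposition, which is unique.
  · refine withDensity_congr_ae (Filter.EventuallyEq.symm ?_)
    refine Measure.eq_rnDeriv hrho.ennreal_ofReal hsing ?_
    rw [← hres, Measure.restrict_add_restrict_compl hZ.measurableSet]

/-- Existence, uniqueness and the density of the measure with eventually constant Jacobi
coefficients. -/
theorem eventually_const_jacobi (hpos : ∀ k, 0 < γ k) (hγ : ∀ k, K < k → γ k = p)
    {a : ℝ} (ha : ∏ i ∈ Finset.range (K + 1), γ i = a) {D : ℝ → ℝ}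
    (hD : ∀ x, (bernsteinSzego γ K p).eval x = D x) :
    (∃! μ : Measure ℝ, IsProbabilityMeasure μ ∧ HasJacobiCoefficients μ (fun _ => 0) γ) ∧
      (∀ x ∈ Set.Ioo (-2 * √p) (2 * √p), 0 < D x) ∧
      ∀ μ : Measure ℝ, IsProbabilityMeasure μ → HasJacobiCoefficients μ (fun _ => 0) γ →
        IsAbsContPartDensity μ (rho a p D) := by
  obtain rfl : (fun x => (bernsteinSzego γ K p).eval x) = D := funext hD
  have hp : 0 < p := hγ (K + 1) (by omega) ▸ hpos (K + 1)
  have hle : ∀ k, γ k ≤ p + ∑ i ∈ Finset.range (K + 1), γ i := by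
    intro k
    have hsum : 0 ≤ ∑ i ∈ Finset.range (K + 1), γ i := Finset.sum_nonneg fun i _ => (hpos i).le
    by_cases hk : K < k
    · rw [hγ k hk]
      linarith
    · have := Finset.single_le_sum (f := γ) (fun i _ => (hpos i).le)
        (Finset.mem_range.2 (show k < K + 1 by omega))
      linarith
  obtain ⟨μ, hμ, hJ⟩ := exists_hasJacobiCoefficients hle hpos
  refine ⟨⟨μ, ⟨hμ, hJ⟩, ?_⟩, ?_, ?_⟩
  · rintro ν ⟨hν, hJ'⟩
    exact hJ'.unique (fun n => by rw [abs_of_pos (hpos n)]; exact hle n) hJ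
  · exact fun x hx => bernsteinSzego_eval_pos hpos hp (sq_lt_four_mul hp.le hx)
  · intro ν hν hJ'
    rw [← ha]
    exact hJ'.isAbsContPartDensity hpos hle hγ

theorem caseCoeff_pos {n : ℕ} {q : Fin n → ℝ} (hq : ∀ i, 0 < q i) (hp : 0 < p) (k : ℕ) :
    0 < caseCoeff q p k := by
  unfold caseCoeff
  split_ifs
  exacts [hq _, hp]

theorem caseCoeff_of_le {n : ℕ} (q : Fin n → ℝ) (p : ℝ) {k : ℕ} (hk : n ≤ k) :
    caseCoeff q p k = p :=
  dif_neg (by omega)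

end Density

theorem corollary5p2 (p₀ p₁ p₂ p : ℝ) (hp₀ : 0 < p₀) (hp₁ : 0 < p₁) (hp₂ : 0 < p₂) (hp : 0 < p) :
    -- the case n = 1
    ((∃! μ : Measure ℝ, IsProbabilityMeasure μ ∧
        HasJacobiCoefficients μ (fun _ => 0) (caseCoeff ![p₀] p)) ∧
      (∀ x ∈ Set.Ioo (-2 * √p) (2 * √p), 0 < denom1 p₀ p x) ∧
      ∀ μ : Measure ℝ, IsProbabilityMeasure μ →
        HasJacobiCoefficients μ (fun _ => 0) (caseCoeff ![p₀] p) →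
        IsAbsContPartDensity μ (rho p₀ p (denom1 p₀ p))) ∧
    -- the case n = 2
    ((∃! μ : Measure ℝ, IsProbabilityMeasure μ ∧
        HasJacobiCoefficients μ (fun _ => 0) (caseCoeff ![p₀, p₁] p)) ∧
      (∀ x ∈ Set.Ioo (-2 * √p) (2 * √p), 0 < denom2 p₀ p₁ p x) ∧
      ∀ μ : Measure ℝ, IsProbabilityMeasure μ →
        HasJacobiCoefficients μ (fun _ => 0) (caseCoeff ![p₀, p₁] p) →
        IsAbsContPartDensity μ (rho (p₀ * p₁) p (denom2 p₀ p₁ p))) ∧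
    -- the case n = 3
    ((∃! μ : Measure ℝ, IsProbabilityMeasure μ ∧
        HasJacobiCoefficients μ (fun _ => 0) (caseCoeff ![p₀, p₁, p₂] p)) ∧
      (∀ x ∈ Set.Ioo (-2 * √p) (2 * √p), 0 < denom3 p₀ p₁ p₂ p x) ∧
      ∀ μ : Measure ℝ, IsProbabilityMeasure μ →
        HasJacobiCoefficients μ (fun _ => 0) (caseCoeff ![p₀, p₁, p₂] p) →
        IsAbsContPartDensity μ (rho (p₀ * p₁ * p₂) p (denom3 p₀ p₁ p₂ p))) := by
  -- K = n - 1 is the last index with a free coefficient; the denominators are then D expanded.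
  refine ⟨eventually_const_jacobi (K := 0) (caseCoeff_pos (fun i => ?_) hp)
      (fun k hk => caseCoeff_of_le _ _ hk) ?_ fun x => ?_,
    eventually_const_jacobi (K := 1) (caseCoeff_pos (fun i => ?_) hp)
      (fun k hk => caseCoeff_of_le _ _ hk) ?_ fun x => ?_,
    eventually_const_jacobi (K := 2) (caseCoeff_pos (fun i => ?_) hp)
      (fun k hk => caseCoeff_of_le _ _ hk) ?_ fun x => ?_⟩
  · fin_cases i; simpa
  · simp [caseCoeff]
  · simp [bernsteinSzego, jacobiPoly, caseCoeff, denom1]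
    ring
  · fin_cases i <;> simpa
  · simp [caseCoeff, Finset.prod_range_succ]
  · simp [bernsteinSzego, jacobiPoly, caseCoeff, denom2]
    ring
  · fin_cases i <;> simpa
  · simp [caseCoeff, Finset.prod_range_succ]
  · simp [bernsteinSzego, jacobiPoly, caseCoeff, denom3]
    ring
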